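/- Let $K$ be a compact (Hausdorff) hypergroup with identity $e$, involution $x\mapsto\check x$ and convolution $*$ of bounded regular Borel measures; that is, $*$ is associative, each $\delta_x*\delta_y$ is a regular Borel probability measure with compact support, the maps $(x,y)\mapsto\delta_x*\delta_y$ and $(x,y)\mapsto\operatorname{supp}(\delta_x*\delta_y)$ are continuous for the weak topology and the Michael topology respectively, $\delta_e*\delta_x=\delta_x*\delta_e=\delta_x$, the involution is continuous with $(\delta_x*\delta_y)\check{\ }=\delta_{\check y}*\delta_{\check x}$, and $e\in\operatorname{supp}(\delta_x*\delta_y)$ if and only if $x=\check y$. Write $f(x*y)=\int_K f\,d(\delta_x*\delta_y)$; for bounded regular Borel measures $\mu,\nu$ one has $\int_K f\,d(\mu*\nu)=\int_K\int_K f(x*y)\,d\mu(x)\,d\nu(y)$ for all continuous $f$. Let $\omega$ be a left Haar measure on $K$, i.e. a non-zero positive Radon measure with $\delta_x*\omega=\omega$ for all $x\in K$, and let $L^p(K)=L^p(K,\omega)$ be the complex Lebesgue spaces. For $A,B\subseteq K$ put $A*B=\bigcup_{a\in A,\,b\in B}\operatorname{supp}(\delta_a*\delta_b)$, $A^1=A$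 and $A^{n+1}=A^n*A$. Let $\sigma$ be a regular Borel probability measure on $K$ that is adapted, i.e. $$K=\overline{\bigcup_{n=1}^\infty\bigl(\operatorname{supp}\sigma\cup(\operatorname{supp}\sigma)\check{\ }\bigr)^n}.$$ For $1\le p\le\infty$ let $H^p_\sigma(K)=\{f\in L^p(K):\sigma*f=f\}$, where $(\sigma*f)(x)=\int_K f(\check y*x)\,d\sigma(y)$ and the equation is an equality in $L^p(K)$, i.e. it holds $\omega$-almost everywhere. Then $H^p_\sigma(K)=\mathbb{C}1$ for every $1\le p\le\infty$; that is, the $\sigma$-harmonic $L^p$-functions on $K$ are exactly the (classes of) constant functions. -/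

import Mathlib

open MeasureTheory Topology
open scoped CompactlySupported ENNReal

/-- A (locally compact) hypergroup.  The convolution on the bounded regular Borel measures is
recorded by its values `conv x y = δ_x * δ_y` on point masses, which determine it through
`∫ f d(μ * ν) = ∫∫ (∫ f d(δ_x * δ_y)) dμ(x) dν(y)`. -/
class Hypergroup (K : Type*) [TopologicalSpace K] [T2Space K] [LocallyCompactSpace K]
    [MeasurableSpace K] [BorelSpace K] where
  /-- The probability measure `δ_x * δ_y`. -/
  conv : K → K → ProbabilityMeasure K
  /-- The identity `e`. -/
  one : K
  /-- The involution. -/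
  inv : K → K
  regular_conv : ∀ x y, (conv x y : Measure K).Regular
  isCompact_support_conv : ∀ x y, IsCompact (conv x y : Measure K).support
  /-- `(x, y) ↦ supp (δ_x * δ_y)` is continuous for the Michael (Vietoris) topology. -/
  continuous_support_conv : Continuous[instTopologicalSpaceProd, TopologicalSpace.vietoris K]
    fun q : K × K => (conv q.1 q.2 : Measure K).support
  /-- `(x, y) ↦ δ_x * δ_y` is continuous for the weak topology of measures. -/
  continuous_conv : Continuous fun q : K × K => conv q.1 q.2
  /-- `(δ_x * δ_y) * δ_z = δ_x * (δ_y * δ_z)`, tested against `C_c(K)`. -/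
  conv_assoc : ∀ (x y z : K) (f : C_c(K, ℂ)),
    ∫ s, (∫ t, f t ∂(conv s z : Measure K)) ∂(conv x y : Measure K) =
      ∫ s, (∫ t, f t ∂(conv x s : Measure K)) ∂(conv y z : Measure K)
  one_conv : ∀ x, (conv one x : Measure K) = Measure.dirac x
  conv_one : ∀ x, (conv x one : Measure K) = Measure.dirac x
  continuous_inv : Continuous inv
  inv_inv : ∀ x, inv (inv x) = x
  map_inv_conv : ∀ x y,
    (conv x y : Measure K).map inv = (conv (inv y) (inv x) : Measure K)
  one_mem_support_conv_iff : ∀ x y, one ∈ (conv x y : Measure K).support ↔ x = inv y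

namespace Hypergroup

variable {K : Type*} [TopologicalSpace K] [T2Space K] [LocallyCompactSpace K]
  [MeasurableSpace K] [BorelSpace K] [Hypergroup K]

/-- `f(x * y) = ∫ f d(δ_x * δ_y)`. -/
noncomputable def translate (f : K → ℂ) (x y : K) : ℂ :=
  ∫ t, f t ∂(conv x y : Measure K)

/-- The convolution `(μ * f)(x) = ∫ f(y̌ * x) dμ(y)` of a positive measure and a function. -/
noncomputable def measureConv (μ : Measure K) (f : K → ℂ) (x : K) : ℂ :=
  ∫ y, translate f (inv y) x ∂μ

/-- The Radon measure `ω` is a left Haar measure: `ω ≠ 0` and `δ_x * ω = ω` for all `x`, tested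
against `C_c(K)`. -/
structure IsLeftHaar (ω : Measure K) [ω.Regular] : Prop where
  ne_zero : ω ≠ 0
  left_invariant : ∀ (x : K) (f : C_c(K, ℂ)), ∫ t, translate f x t ∂ω = ∫ t, f t ∂ω

/-- The product of two subsets, `A * B = ⋃ supp (δ_a * δ_b)`. -/
def setMul (A B : Set K) : Set K :=
  ⋃ a ∈ A, ⋃ b ∈ B, (conv a b : Measure K).support

/-- The powers of a subset, with `A ^ 0 = {e}` (so that `A ^ 1 = A`). -/
def setPow (A : Set K) : ℕ → Set K
  | 0 => {one}
  | n + 1 => setMul (setPow A n) A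

/-- A positive measure `μ` is adapted if `⋃_{n ≥ 1} (supp μ ∪ (supp μ)ˇ) ^ n` is dense. -/
def IsAdapted (μ : Measure K) : Prop :=
  closure (⋃ n : ℕ, ⋃ _ : 1 ≤ n, setPow (μ.support ∪ inv '' μ.support) n) = Set.univ

/-- The space `H^p_σ(K)` of all `f ∈ L^p(K, ω)` with `σ * f = f` (almost everywhere, as an
equality in `L^p`). -/
def harmonicLp (σ ω : Measure K) (p : ℝ≥0∞) : Set (Lp ℂ p ω) :=
  {f | measureConv σ f =ᵐ[ω] f}

end Hypergroup

/-! Harmonicity means invariance under the Markov kernel `walk σ x` = σ̌ * δ_x, and left invariance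
makes ω stationary for it (`IsLeftInvariant.bind_walk`). As ω is finite, L^p lies in L^1, and it
suffices to treat an integrable real u of mean zero.

The positive part of u is subharmonic, yet stationarity makes its integral equal to that of its
image; equality holds a.e., and almost no point outside A = {u > 0} can jump into A
(`ae_walk_apply_pos_eq_zero`). Stationarity then also forbids jumps from A to its complement, so ω
restricted to A is stationary. Stationary finite measures are left invariant
(`IsLeftInvariant.of_stationary`) and Haar measure is unique up to scale
(`IsLeftInvariant.smul_eq_smul`), so A is null or conull. Thus u has constant sign, and mean zero
forces u = 0 a.e.

The Choquet–Deny step `IsLeftInvariant.of_stationary` is a maximum principle: the maximum set of z ↦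
∫ g(z * t) dν(t) is stable under right multiplication by ǎ for a in supp σ. Adaptedness requires
stability under a as well; `IsLeftInvariant.supp_inv_subset` supplies it by a recurrence argument.
-/

section RegularFamily

/-! ### Mixtures of weakly continuous families of regular measures -/

set_option linter.unusedSectionVars false

variable {X Y : Type*} [TopologicalSpace X] [CompactSpace X] [T2Space X]
  [MeasurableSpace X] [BorelSpace X] [TopologicalSpace Y] [CompactSpace Y] [T2Space Y]
  [MeasurableSpace Y] [BorelSpace Y]

/-- A weakly continuous family of regular probability measures. -/
structure IsRegularFamily (m : X → Measure Y) : Prop where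
  isProbabilityMeasure : ∀ x, IsProbabilityMeasure (m x)
  regular : ∀ x, (m x).Regular
  continuous_integral : ∀ g : Y → ℝ, Continuous g → Continuous fun x => ∫ t, g t ∂(m x)

theorem integrable_of_continuous {E : Type*} [NormedAddCommGroup E] {μ : Measure Y}
    [IsFiniteMeasure μ] {g : Y → E} (hg : Continuous g) : Integrable g μ :=
  hg.integrable_of_hasCompactSupport (HasCompactSupport.of_compactSpace g)

theorem continuous_integral_of_continuous_uncurry (μ : Measure Y) [IsFiniteMeasure μ]
    {f : X → Y → ℝ} (hf : Continuous f.uncurry) : Continuous fun x => ∫ y, f x y ∂μ := by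
  rw [← continuousOn_univ]
  exact continuousOn_integral_of_compact_support isCompact_univ hf.continuousOn
    fun _ x _ hx => absurd (Set.mem_univ x) hx

theorem integral_integral_swap_of_continuous (μ : Measure X) (ν : Measure Y) [IsFiniteMeasure μ]
    [IsFiniteMeasure ν] {f : X → Y → ℝ} (hf : Continuous f.uncurry) :
    ∫ x, ∫ y, f x y ∂ν ∂μ = ∫ y, ∫ x, f x y ∂μ ∂ν :=
  integral_integral_swap_of_hasCompactSupport hf (HasCompactSupport.of_compactSpace _)

theorem ext_of_integral_continuous {μ ν : Measure Y} [μ.Regular] [ν.Regular]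
    (h : ∀ g : Y → ℝ, Continuous g → ∫ t, g t ∂μ = ∫ t, g t ∂ν) : μ = ν :=
  Measure.ext_of_integral_eq_on_compactlySupported fun f => h f f.continuous

/-- A compact set inside an open set is separated from its complement by a function whose
integrals interpolate the measures. -/
theorem exists_continuous_measure_le {C U : Set Y} (hC : IsClosed C) (hU : IsOpen U)
    (h : C ⊆ U) : ∃ g : Y → ℝ, Continuous g ∧ ∃ D : Set Y, IsClosed D ∧ D ⊆ U ∧
      ∀ (μ : Measure Y) [IsFiniteMeasure μ],
        μ C ≤ ENNReal.ofReal (∫ t, g t ∂μ) ∧ ENNReal.ofReal (∫ t, g t ∂μ) ≤ μ D := by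
  obtain ⟨g, hgU, hg1, hg⟩ := exists_tsupport_one_of_isOpen_isClosed hU
    (isClosed_closure.isCompact) hC h
  refine ⟨g, g.continuous, tsupport g, isClosed_tsupport g, hgU, fun μ _ => ?_⟩
  rw [ofReal_integral_eq_lintegral_ofReal (integrable_of_continuous g.continuous)
    (Filter.Eventually.of_forall fun x => (hg x).1)]
  constructor
  · rw [← lintegral_indicator_one hC.measurableSet]
    refine lintegral_mono fun x => ?_
    by_cases hx : x ∈ C
    · simp [hx, hg1 hx]
    · simp [hx]
  · rw [← lintegral_indicator_one (isClosed_tsupport g).measurableSet]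
    refine lintegral_mono fun x => ?_
    by_cases hx : x ∈ tsupport g
    · simpa [hx] using (hg x).2
    · simp [image_eq_zero_of_notMem_tsupport hx]

namespace IsRegularFamily

variable {m : X → Measure Y}

theorem lowerSemicontinuous_apply (hm : IsRegularFamily m) {U : Set Y} (hU : IsOpen U) :
    LowerSemicontinuous fun x => m x U := by
  intro x c hc
  have := hm.regular x
  obtain ⟨C, hCU, hC, hcC⟩ := hU.exists_lt_isCompact hc
  obtain ⟨g, hg, D, -, hDU, hgD⟩ := exists_continuous_measure_le hC.isClosed hU hCU
  have := hm.isProbabilityMeasure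
  have hcont := ENNReal.continuous_ofReal.comp (hm.continuous_integral g hg)
  filter_upwards [hcont.continuousAt.eventually (lt_mem_nhds (hcC.trans_le (hgD (m x)).1))]
    with z hz
  exact hz.trans_le ((hgD (m z)).2.trans (measure_mono hDU))

protected theorem measurable (hm : IsRegularFamily m) : Measurable m := by
  have := hm.isProbabilityMeasure
  refine Measurable.measure_of_isPiSystem_of_isProbabilityMeasure
    (S := {U : Set Y | IsOpen U}) (BorelSpace.measurable_eq) isPiSystem_isOpen fun U hU => ?_
  exact (hm.lowerSemicontinuous_apply hU).measurable

theorem isProbabilityMeasure_bind (hm : IsRegularFamily m) (μ : Measure X)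
    [IsProbabilityMeasure μ] : IsProbabilityMeasure (μ.bind m) := by
  have := hm.isProbabilityMeasure
  constructor
  rw [Measure.bind_apply MeasurableSet.univ hm.measurable.aemeasurable]
  simp

theorem isFiniteMeasure_bind (hm : IsRegularFamily m) (μ : Measure X)
    [IsFiniteMeasure μ] : IsFiniteMeasure (μ.bind m) := by
  have := hm.isProbabilityMeasure
  constructor
  rw [Measure.bind_apply MeasurableSet.univ hm.measurable.aemeasurable]
  simp

/-- A Dini-type argument: inner regularity gives a closed set at each point, semicontinuity of g
lets it serve a neighbourhood, and compactness of X takes a finite union. -/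
theorem exists_isClosed_forall_le (hm : IsRegularFamily m) {U : Set Y} (hU : IsOpen U)
    {g : X → NNReal} (hg : UpperSemicontinuous g) (hgU : ∀ x, g x ≤ m x U) {ε : ℝ≥0∞}
    (hε : ε ≠ 0) : ∃ C : Set Y, IsClosed C ∧ C ⊆ U ∧ ∀ x, g x ≤ m x C + ε := by
  have hprob := hm.isProbabilityMeasure
  have key : ∃ C : Set Y, IsClosed C ∧ C ⊆ U ∧ ∀ x ∈ (Set.univ : Set X), g x ≤ m x C + ε := by
    refine isCompact_univ.induction_on
      (p := fun S => ∃ C : Set Y, IsClosed C ∧ C ⊆ U ∧ ∀ x ∈ S, g x ≤ m x C + ε) ?_ ?_ ?_ ?_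
    · exact ⟨∅, isClosed_empty, Set.empty_subset _, by simp⟩
    · rintro s t hst ⟨C, hC, hCU, h⟩
      exact ⟨C, hC, hCU, fun x hx => h x (hst hx)⟩
    · rintro s t ⟨C, hC, hCU, h⟩ ⟨D, hD, hDU, h'⟩
      refine ⟨C ∪ D, hC.union hD, Set.union_subset hCU hDU, ?_⟩
      rintro x (hx | hx)
      · exact (h x hx).trans (by gcongr; exact Set.subset_union_left)
      · exact (h' x hx).trans (by gcongr; exact Set.subset_union_right)
    · intro y _
      have hreg := hm.regular y
      obtain ⟨C, hCU, hC, hlt⟩ : ∃ C, C ⊆ U ∧ IsCompact C ∧ (g y : ℝ≥0∞) < m y C + ε := by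
        rcases eq_or_ne (m y U) 0 with h0 | h0
        · refine ⟨∅, Set.empty_subset _, isCompact_empty, ?_⟩
          have := hgU y
          rw [h0, nonpos_iff_eq_zero] at this
          rw [this]
          simpa using pos_iff_ne_zero.2 hε
        · obtain ⟨C, hCU, hC, hlt⟩ := hU.exists_lt_isCompact
            (ENNReal.sub_lt_self (measure_ne_top (m y) U) h0 hε)
          refine ⟨C, hCU, hC, (hgU y).trans_lt ?_⟩
          rcases eq_or_ne ε ∞ with rfl | hε'
          · simp
          · exact (ENNReal.cancel_of_ne hε').lt_add_of_tsub_lt_right hlt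
      obtain ⟨f, hf, D, hD, hDU, hfD⟩ := exists_continuous_measure_le hC.isClosed hU hCU
      have hlt' : (g y : ℝ≥0∞) < ENNReal.ofReal (∫ t, f t ∂m y) + ε :=
        hlt.trans_le (by gcongr; exact (hfD (m y)).1)
      obtain ⟨c, hgc, hc⟩ := ENNReal.lt_iff_exists_nnreal_btwn.1 hlt'
      have hcont : Continuous fun x => ENNReal.ofReal (∫ t, f t ∂m x) + ε :=
        (ENNReal.continuous_ofReal.comp (hm.continuous_integral f hf)).add continuous_const
      have hev : ∀ᶠ x in 𝓝 y, (g x : ℝ≥0∞) ≤ m x D + ε := by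
        filter_upwards [hcont.continuousAt.eventually (lt_mem_nhds hc),
          hg y c (by exact_mod_cast hgc)] with x hx hx'
        calc (g x : ℝ≥0∞) ≤ c := by exact_mod_cast hx'.le
          _ ≤ _ := hx.le
          _ ≤ _ := by gcongr; exact (hfD (m x)).2
      exact ⟨_, mem_nhdsWithin_of_mem_nhds hev, D, hD, hDU, fun x hx => hx⟩
  obtain ⟨C, hC, hCU, h⟩ := key
  exact ⟨C, hC, hCU, fun x => h x (Set.mem_univ x)⟩

/-- Without second countability, regularity of a mixture is not automatic; it is what allows
identities of measures to be tested on continuous functions. -/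
theorem regular_bind (hm : IsRegularFamily m) (μ : Measure X) [IsFiniteMeasure μ] [μ.Regular] :
    (μ.bind m).Regular := by
  have hprob := hm.isProbabilityMeasure
  have hfin := hm.isFiniteMeasure_bind μ
  have hinner : (μ.bind m).InnerRegularWRT IsClosed IsOpen := by
    intro U hU r hr
    obtain ⟨δ, hδ, hrδ⟩ : ∃ δ : ℝ≥0∞, δ ≠ 0 ∧ r + δ < μ.bind m U := by
      obtain ⟨c, hc, hc'⟩ := exists_between hr
      refine ⟨c - r, (tsub_pos_of_lt hc).ne', ?_⟩
      rwa [add_tsub_cancel_of_le hc.le]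
    -- The loss δ is paid twice: ε · μ(X) for the uniform closed approximation and ε for replacing x
    -- ↦ `m x U` by an upper semicontinuous minorant.
    set ε : ℝ≥0∞ := δ / (μ Set.univ + 1) with hεdef
    have hε : ε ≠ 0 := ENNReal.div_ne_zero.2 ⟨hδ, by finiteness⟩
    have hεδ : ε * μ Set.univ + ε = δ := by
      rw [← mul_add_one, hεdef]
      exact ENNReal.div_mul_cancel (by simp) (by finiteness)
    have happly : ∀ s, MeasurableSet s → μ.bind m s = ∫⁻ x, m x s ∂μ := fun s hs =>
      Measure.bind_apply hs hm.measurable.aemeasurable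
    have hcoe : ∀ x, ((m x U).toNNReal : ℝ≥0∞) = m x U := fun x =>
      ENNReal.coe_toNNReal (measure_ne_top _ _)
    obtain ⟨g, hgle, hg, hint⟩ := exists_upperSemicontinuous_le_lintegral_le (μ := μ)
      (fun x => (m x U).toNNReal)
      (by simp only [hcoe]; rw [← happly U hU.measurableSet]; exact measure_ne_top _ _) hε
    simp only [hcoe] at hint
    rw [← happly U hU.measurableSet] at hint
    obtain ⟨C, hC, hCU, hgC⟩ := hm.exists_isClosed_forall_le hU hg
      (fun x => (hcoe x) ▸ (by exact_mod_cast hgle x)) hε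
    refine ⟨C, hCU, hC, ?_⟩
    have h1 : μ.bind m U ≤ μ.bind m C + δ := by
      calc μ.bind m U ≤ ∫⁻ x, g x ∂μ + ε := hint
        _ ≤ ∫⁻ x, (m x C + ε) ∂μ + ε := by gcongr with x; exact hgC x
        _ = μ.bind m C + δ := by
          rw [lintegral_add_right _ measurable_const, lintegral_const, ← happly C hC.measurableSet,
            add_assoc, hεδ]
    have h2 : r + δ < μ.bind m C + δ := hrδ.trans_le h1
    exact lt_of_add_lt_add_right h2
  have := hinner.weaklyRegular_of_finite
  refine ⟨fun U hU r hr => ?_⟩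
  obtain ⟨C, hCU, hC, h⟩ := hinner hU r hr
  exact ⟨C, hCU, hC.isCompact, h⟩

theorem integral_bind (hm : IsRegularFamily m) {μ : Measure X} [IsFiniteMeasure μ] {E : Type*}
    [NormedAddCommGroup E] [NormedSpace ℝ E] {f : Y → E} (hf : Integrable f (μ.bind m)) :
    ∫ t, f t ∂(μ.bind m) = ∫ x, ∫ t, f t ∂(m x) ∂μ :=
  have := hm.isProbabilityMeasure
  have : ProbabilityTheory.IsMarkovKernel (⟨m, hm.measurable⟩ : ProbabilityTheory.Kernel X Y) :=
    ⟨this⟩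
  by
    have h := Measure.comp_eq_comp_const_apply (μ := μ)
      (κ := (⟨m, hm.measurable⟩ : ProbabilityTheory.Kernel X Y))
    have h' := ProbabilityTheory.Kernel.integral_comp (h ▸ hf :)
    rw [← h] at h'
    simpa using h'

theorem ae_integrable (hm : IsRegularFamily m) {μ : Measure X} [IsFiniteMeasure μ] {E : Type*}
    [NormedAddCommGroup E] {f : Y → E} (hf : Integrable f (μ.bind m)) :
    ∀ᵐ x ∂μ, Integrable f (m x) :=
  have := hm.isProbabilityMeasure
  have : ProbabilityTheory.IsMarkovKernel (⟨m, hm.measurable⟩ : ProbabilityTheory.Kernel X Y) :=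
    ⟨this⟩
  Measure.ae_integrable_of_integrable_comp
    (κ := (⟨m, hm.measurable⟩ : ProbabilityTheory.Kernel X Y)) hf

theorem integrable_integral_norm (hm : IsRegularFamily m) {μ : Measure X} [IsFiniteMeasure μ]
    {E : Type*} [NormedAddCommGroup E] {f : Y → E} (hf : Integrable f (μ.bind m)) :
    Integrable (fun x => ∫ t, ‖f t‖ ∂(m x)) μ :=
  have := hm.isProbabilityMeasure
  have : ProbabilityTheory.IsMarkovKernel (⟨m, hm.measurable⟩ : ProbabilityTheory.Kernel X Y) :=
    ⟨this⟩
  Measure.integrable_integral_norm_of_integrable_comp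
    (κ := (⟨m, hm.measurable⟩ : ProbabilityTheory.Kernel X Y)) hf

/-- The points of N already send mass μ(N) into N. Invariance and finiteness leave no room for
inflow from outside. -/
theorem ae_apply_eq_zero_of_absorbing {m : X → Measure X}
    (hm : IsRegularFamily m) {μ : Measure X} [IsFiniteMeasure μ] (hμ : μ.bind m = μ) {N : Set X}
    (hN : MeasurableSet N) (h : ∀ᵐ x ∂μ, x ∈ N → m x Nᶜ = 0) : ∀ᵐ x ∂μ, x ∉ N → m x N = 0 := by
  have hprob := hm.isProbabilityMeasure
  have hmeas : Measurable fun x => m x N := (Measure.measurable_coe hN).comp hm.measurable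
  have h1 : ∫⁻ x in N, m x N ∂μ = μ N := by
    rw [← setLIntegral_one]
    refine setLIntegral_congr_fun_ae hN ?_
    filter_upwards [h] with x hx hxN
    exact (prob_compl_eq_zero_iff hN).1 (hx hxN)
  have h2 : μ N + ∫⁻ x in Nᶜ, m x N ∂μ = μ N := by
    conv_rhs => rw [← hμ, Measure.bind_apply hN hm.measurable.aemeasurable,
      ← lintegral_add_compl _ hN, h1]
  have h3 : ∫⁻ x in Nᶜ, m x N ∂μ = 0 := by
    have : μ N + ∫⁻ x in Nᶜ, m x N ∂μ = μ N + 0 := by rw [h2, add_zero]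
    exact (ENNReal.add_right_inj (measure_ne_top μ N)).1 this
  rw [lintegral_eq_zero_iff hmeas] at h3
  exact (ae_restrict_iff' hN.compl).1 h3

end IsRegularFamily

end RegularFamily

/-! ### Calculus of supports -/

namespace Hypergroup

section Compact

set_option linter.unusedSectionVars false

variable {K : Type*} [TopologicalSpace K] [T2Space K] [CompactSpace K]
  [MeasurableSpace K] [BorelSpace K] [Hypergroup K]

instance instRegularConv (x y : K) : (conv x y : Measure K).Regular := regular_conv x y

/-- The support of `δ_x * δ_y`. -/
abbrev supp (x y : K) : Set K := (conv x y : Measure K).support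

theorem continuous_integral_conv {g : K → ℝ} (hg : Continuous g) :
    Continuous fun q : K × K => ∫ t, g t ∂(conv q.1 q.2 : Measure K) :=
  ProbabilityMeasure.continuous_iff_forall_continuous_integral.1 continuous_conv
    (BoundedContinuousFunction.mkOfCompact ⟨g, hg⟩)

theorem continuous_integral_conv_comp {X : Type*} [TopologicalSpace X] {g : K → ℝ}
    (hg : Continuous g) {a b : X → K} (ha : Continuous a) (hb : Continuous b) :
    Continuous fun x => ∫ t, g t ∂(conv (a x) (b x) : Measure K) :=
  (continuous_integral_conv hg).comp (ha.prodMk hb)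

theorem isRegularFamily_conv {X : Type*} [TopologicalSpace X] {a b : X → K} (ha : Continuous a)
    (hb : Continuous b) : IsRegularFamily fun x => (conv (a x) (b x) : Measure K) where
  isProbabilityMeasure _ := inferInstance
  regular _ := inferInstance
  continuous_integral _ hg := continuous_integral_conv_comp hg ha hb

/-- A continuous function on a compact hypergroup, complexified, as a test function. -/
noncomputable def testFunction (g : K → ℝ) (hg : Continuous g) : C_c(K, ℂ) :=
  ⟨⟨fun t => (g t : ℂ), Complex.continuous_ofReal.comp hg⟩, HasCompactSupport.of_compactSpace _⟩

@[simp]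
theorem testFunction_apply (g : K → ℝ) (hg : Continuous g) (t : K) :
    testFunction g hg t = (g t : ℂ) := rfl

theorem integral_conv_assoc {g : K → ℝ} (hg : Continuous g) (x y z : K) :
    ∫ s, (∫ t, g t ∂(conv s z : Measure K)) ∂(conv x y : Measure K) =
      ∫ s, (∫ t, g t ∂(conv x s : Measure K)) ∂(conv y z : Measure K) := by
  have h := conv_assoc x y z (testFunction g hg)
  simp only [testFunction_apply, integral_complex_ofReal] at h
  exact_mod_cast h

theorem _root_.MeasureTheory.Measure.eqOn_zero_support_of_integral_eq_zero
    {X : Type*} [TopologicalSpace X] [CompactSpace X] [MeasurableSpace X] [BorelSpace X]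
    {μ : Measure X} [IsFiniteMeasure μ] {g : X → ℝ} (hg : Continuous g) (h0 : ∀ x, 0 ≤ g x)
    (h : ∫ x, g x ∂μ = 0) {x : X} (hx : x ∈ μ.support) : g x = 0 := by
  have hint : Integrable g μ :=
    hg.integrable_of_hasCompactSupport (HasCompactSupport.of_compactSpace g)
  rw [integral_eq_zero_iff_of_nonneg h0 hint] at h
  exact Measure.support_subset_of_isClosed (isClosed_singleton.preimage hg) h hx

theorem integral_eq_zero_of_eqOn_support {μ : Measure K} [μ.Regular] {g : K → ℝ}
    (h : ∀ x ∈ μ.support, g x = 0) : ∫ x, g x ∂μ = 0 :=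
  integral_eq_zero_of_ae (Filter.mem_of_superset Measure.support_mem_ae_of_regular h)

theorem exists_continuous_pos_of_notMem {M : Set K} (hM : IsClosed M) {u : K} (hu : u ∉ M) :
    ∃ g : K → ℝ, Continuous g ∧ (∀ x, 0 ≤ g x) ∧ (∀ x ∈ M, g x = 0) ∧ g u ≠ 0 := by
  obtain ⟨g, hg0, hg1, hg⟩ := exists_continuous_zero_one_of_isClosed hM isClosed_singleton
    (Set.disjoint_singleton_right.2 hu)
  exact ⟨g, g.continuous, fun x => (hg x).1, fun x hx => hg0 hx, by simp [hg1 rfl]⟩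

/-- Associativity is known only for integrals. A nonnegative continuous function vanishing on M but
not at a stray point transfers it to supports, since a zero integral forces vanishing on the
support. -/
theorem supp_assoc_right {M : Set K} (hM : IsClosed M) {x y z : K}
    (h : ∀ t ∈ supp x y, supp t z ⊆ M) : ∀ s ∈ supp y z, supp x s ⊆ M := by
  intro s hs u hu
  by_contra huM
  obtain ⟨g, hg, hg0, hgM, hgu⟩ := exists_continuous_pos_of_notMem hM huM
  have h1 := integral_conv_assoc hg x y z
  rw [integral_eq_zero_of_eqOn_support fun t ht =>
    integral_eq_zero_of_eqOn_support fun w hw => hgM w (h t ht hw)] at h1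
  exact hgu <| Measure.eqOn_zero_support_of_integral_eq_zero hg hg0
    (Measure.eqOn_zero_support_of_integral_eq_zero
      (continuous_integral_conv_comp hg continuous_const continuous_id)
      (fun _ => integral_nonneg hg0) h1.symm hs) hu

theorem supp_assoc_left {M : Set K} (hM : IsClosed M) {x y z : K}
    (h : ∀ s ∈ supp y z, supp x s ⊆ M) : ∀ t ∈ supp x y, supp t z ⊆ M := by
  intro s hs u hu
  by_contra huM
  obtain ⟨g, hg, hg0, hgM, hgu⟩ := exists_continuous_pos_of_notMem hM huM
  have h1 := integral_conv_assoc hg x y z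
  rw [integral_eq_zero_of_eqOn_support (μ := (conv y z : Measure K)) fun t ht =>
    integral_eq_zero_of_eqOn_support fun w hw => hgM w (h t ht hw)] at h1
  exact hgu <| Measure.eqOn_zero_support_of_integral_eq_zero hg hg0
    (Measure.eqOn_zero_support_of_integral_eq_zero
      (continuous_integral_conv_comp hg continuous_id continuous_const)
      (fun _ => integral_nonneg hg0) h1 hs) hu

theorem isOpen_setOf_supp_subset {X : Type*} [TopologicalSpace X] {a b : X → K}
    (ha : Continuous a) (hb : Continuous b) {U : Set K} (hU : IsOpen U) :
    IsOpen {x | supp (a x) (b x) ⊆ U} :=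
  letI := TopologicalSpace.vietoris K
  (hU.powerset_vietoris.preimage continuous_support_conv).preimage (ha.prodMk hb)

theorem isOpen_setOf_supp_inter_nonempty {X : Type*} [TopologicalSpace X] {a b : X → K}
    (ha : Continuous a) (hb : Continuous b) {U : Set K} (hU : IsOpen U) :
    IsOpen {x | (supp (a x) (b x) ∩ U).Nonempty} :=
  letI := TopologicalSpace.vietoris K
  ((TopologicalSpace.vietoris.isOpen_inter_nonempty_of_isOpen hU).preimage
    continuous_support_conv).preimage (ha.prodMk hb)

theorem isClosed_setOf_supp_subset {X : Type*} [TopologicalSpace X] {a b : X → K}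
    (ha : Continuous a) (hb : Continuous b) {M : Set K} (hM : IsClosed M) :
    IsClosed {x | supp (a x) (b x) ⊆ M} := by
  rw [← isOpen_compl_iff]
  convert isOpen_setOf_supp_inter_nonempty ha hb hM.isOpen_compl using 1
  ext x
  simp [Set.inter_compl_nonempty_iff]

theorem isClosed_setOf_mem_supp : IsClosed {q : (K × K) × K | q.2 ∈ supp q.1.1 q.1.2} := by
  rw [← isOpen_compl_iff, isOpen_iff_mem_nhds]
  rintro ⟨⟨a, b⟩, u⟩ hu
  obtain ⟨V, W, hV, hW, hsub, huW, hVW⟩ := SeparatedNhds.of_isCompact_isCompact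
    (Measure.isClosed_support (μ := (conv a b : Measure K))).isCompact
    (isCompact_singleton (x := u)) (Set.disjoint_singleton_right.2 hu)
  have hV' : IsOpen {q : (K × K) × K | supp q.1.1 q.1.2 ⊆ V} :=
    isOpen_setOf_supp_subset (by fun_prop) (by fun_prop) hV
  filter_upwards [hV'.mem_nhds hsub, (hW.preimage continuous_snd).mem_nhds
    (show ((a, b), u) ∈ _ from huW rfl)] with q hq hq' hmem
  exact Set.disjoint_left.1 hVW (hq hmem) hq'

theorem mem_setMul {A B : Set K} {u : K} :
    u ∈ setMul A B ↔ ∃ a ∈ A, ∃ b ∈ B, u ∈ supp a b := by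
  simp [setMul]

theorem isClosed_setMul {A B : Set K} (hA : IsClosed A) (hB : IsClosed B) :
    IsClosed (setMul A B) := by
  have h : IsClosed ({q : (K × K) × K | q.2 ∈ supp q.1.1 q.1.2} ∩ Prod.fst ⁻¹' (A ×ˢ B)) :=
    isClosed_setOf_mem_supp.inter ((hA.prod hB).preimage continuous_fst)
  convert (h.isCompact.image continuous_snd).isClosed using 1
  ext u
  simp only [mem_setMul, Set.mem_image, Set.mem_inter_iff, Set.mem_preimage, Set.mem_prod]
  constructor
  · rintro ⟨a, ha, b, hb, hu⟩
    exact ⟨((a, b), u), ⟨hu, ha, hb⟩, rfl⟩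
  · rintro ⟨⟨⟨a, b⟩, u⟩, ⟨hu, ha, hb⟩, rfl⟩
    exact ⟨a, ha, b, hb, hu⟩

theorem exists_mem_supp_of_mem_supp {x y z t u : K} (ht : t ∈ supp x y) (hu : u ∈ supp t z) :
    ∃ s ∈ supp y z, u ∈ supp x s := by
  have hcl : IsClosed (setMul {x} (supp y z)) :=
    isClosed_setMul isClosed_singleton Measure.isClosed_support
  have := supp_assoc_left hcl (x := x) (y := y) (z := z)
    (fun s hs w hw => mem_setMul.2 ⟨x, rfl, s, hs, hw⟩) t ht hu
  simpa [mem_setMul] using this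

theorem support_dirac_self {x : K} : (Measure.dirac x : Measure K).support = {x} := by
  apply subset_antisymm
  · exact Measure.support_subset_of_isClosed isClosed_singleton
      (by simp)
  · rintro _ rfl
    rw [Measure.mem_support_iff_forall]
    intro U hU
    exact lt_of_lt_of_le (by simp [mem_of_mem_nhds hU])
      (Measure.le_dirac_apply)

theorem supp_one_left (x : K) : supp one x = {x} := by
  rw [supp, one_conv, support_dirac_self]

theorem supp_one_right (x : K) : supp x one = {x} := by
  rw [supp, conv_one, support_dirac_self]

/-- The involution as a homeomorphism. -/
def invHomeomorph (K : Type*) [TopologicalSpace K] [T2Space K] [CompactSpace K]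
    [MeasurableSpace K] [BorelSpace K] [Hypergroup K] : K ≃ₜ K where
  toFun := inv
  invFun := inv
  left_inv := inv_inv
  right_inv := inv_inv
  continuous_toFun := continuous_inv
  continuous_invFun := continuous_inv

theorem mem_support_map_inv {μ : Measure K} {x : K} :
    x ∈ (μ.map inv).support ↔ inv x ∈ μ.support := by
  have hmap : ∀ U : Set K, (μ.map inv) U = μ (inv ⁻¹' U) := fun U =>
    (invHomeomorph K).toMeasurableEquiv.map_apply U
  simp only [Measure.mem_support_iff_forall, hmap]
  constructor
  · intro h U hU
    have := h (inv ⁻¹' U) (continuous_inv.continuousAt.preimage_mem_nhds hU)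
    simpa [← Set.preimage_comp, Function.comp_def, inv_inv] using this
  · intro h U hU
    refine h _ (continuous_inv.continuousAt.preimage_mem_nhds ?_)
    rwa [inv_inv]

theorem mem_supp_inv_inv {x y z : K} : z ∈ supp (inv y) (inv x) ↔ inv z ∈ supp x y := by
  rw [supp, ← map_inv_conv, mem_support_map_inv]

theorem one_mem_supp_inv_left (x : K) : one ∈ supp (inv x) x :=
  (one_mem_support_conv_iff _ _).2 rfl

theorem one_mem_supp_inv_right (x : K) : one ∈ supp x (inv x) :=
  (one_mem_support_conv_iff _ _).2 (inv_inv x).symm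

/-- The substitute for cancellation: e lies in (x * y) * ž, so reassociating gives s in y * ž with e
in x * s, whence x = š. -/
theorem mem_supp_inv_of_mem_supp {x y z : K} (h : z ∈ supp x y) : x ∈ supp z (inv y) := by
  obtain ⟨s, hs, hs'⟩ := exists_mem_supp_of_mem_supp h (one_mem_supp_inv_right z)
  obtain rfl := (one_mem_support_conv_iff _ _).1 hs'
  have := mem_supp_inv_inv.1 (show s ∈ supp (inv (inv y)) (inv z) by rwa [inv_inv])
  exact this

/-! ### Left-invariant measures -/

/-- Left invariance of a measure, tested against real continuous functions. -/
def IsLeftInvariant (ν : Measure K) : Prop :=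
  ∀ (x : K) (g : K → ℝ), Continuous g →
    ∫ t, ∫ u, g u ∂(conv x t : Measure K) ∂ν = ∫ t, g t ∂ν

theorem IsLeftHaar.isLeftInvariant {ω : Measure K} [ω.Regular] (hω : IsLeftHaar ω) :
    IsLeftInvariant ω := by
  intro x g hg
  have h := hω.left_invariant x (testFunction g hg)
  simp only [translate, testFunction_apply, integral_complex_ofReal] at h
  exact_mod_cast h

theorem integral_map_inv (ν : Measure K) (g : K → ℝ) :
    ∫ t, g t ∂(ν.map inv) = ∫ t, g (inv t) ∂ν :=
  integral_map_equiv (invHomeomorph K).toMeasurableEquiv g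

theorem IsLeftInvariant.integral_conv_right_map_inv {ν : Measure K} (hν : IsLeftInvariant ν)
    (s : K) {g : K → ℝ} (hg : Continuous g) :
    ∫ t, ∫ u, g u ∂(conv t s : Measure K) ∂(ν.map inv) = ∫ t, g t ∂(ν.map inv) := by
  rw [integral_map_inv, integral_map_inv, 
    ← hν (inv s) (fun t => g (inv t)) (hg.comp continuous_inv)]
  congr 1 with t
  rw [← integral_map_inv, map_inv_conv, inv_inv]

theorem IsLeftInvariant.bind_conv {ν : Measure K} [IsFiniteMeasure ν] [ν.Regular]
    (hν : IsLeftInvariant ν) (x : K) : (ν.bind fun t => (conv x t : Measure K)) = ν := by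
  have hm : IsRegularFamily fun t : K => (conv x t : Measure K) :=
    isRegularFamily_conv continuous_const continuous_id
  have := hm.regular_bind ν
  have := hm.isFiniteMeasure_bind ν
  refine ext_of_integral_continuous fun g hg => ?_
  rw [hm.integral_bind (integrable_of_continuous hg), hν x g hg]

instance instRegularMapInv (ν : Measure K) [ν.Regular] : (ν.map inv).Regular :=
  Measure.Regular.map (invHomeomorph K)

theorem IsLeftInvariant.bind_conv_map_inv {ν : Measure K} [IsFiniteMeasure ν] [ν.Regular]
    (hν : IsLeftInvariant ν) (s : K) :
    ((ν.map inv).bind fun t => (conv t s : Measure K)) = ν.map inv := by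
  have hm : IsRegularFamily fun t : K => (conv t s : Measure K) :=
    isRegularFamily_conv continuous_id continuous_const
  have := hm.regular_bind (ν.map inv)
  have := hm.isFiniteMeasure_bind (ν.map inv)
  refine ext_of_integral_continuous fun g hg => ?_
  rw [hm.integral_bind (integrable_of_continuous hg), hν.integral_conv_right_map_inv s hg]

theorem IsLeftInvariant.supp_subset_support {ν : Measure K} [IsFiniteMeasure ν] [ν.Regular]
    (hν : IsLeftInvariant ν) (x : K) {y : K} (hy : y ∈ ν.support) : supp x y ⊆ ν.support := by
  have hm : IsRegularFamily fun t : K => (conv x t : Measure K) :=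
    isRegularFamily_conv continuous_const continuous_id
  have hae : ∀ᵐ t ∂(ν.bind fun t => (conv x t : Measure K)), t ∈ ν.support := by
    rw [hν.bind_conv x]
    exact Measure.support_mem_ae_of_regular
  have hcl : IsClosed {t : K | supp x t ⊆ ν.support} :=
    isClosed_setOf_supp_subset continuous_const continuous_id Measure.isClosed_support
  refine Measure.support_subset_of_isClosed hcl ?_ hy
  filter_upwards [Measure.ae_ae_of_ae_bind hm.measurable.aemeasurable hae] with t ht
  exact Measure.support_subset_of_isClosed Measure.isClosed_support ht

/-- The support absorbs left multiplication; it contains e, because e lies in y̌ * y, and hence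
every x. -/
theorem IsLeftInvariant.support_eq_univ {ν : Measure K} [IsFiniteMeasure ν] [ν.Regular]
    (hν : IsLeftInvariant ν) (h0 : ν ≠ 0) : ν.support = Set.univ := by
  obtain ⟨y, hy⟩ : ν.support.Nonempty := by
    rw [Set.nonempty_iff_ne_empty]
    intro hempty
    have := Measure.measure_compl_support_of_regular (μ := ν)
    rw [hempty, Set.compl_empty, Measure.measure_univ_eq_zero] at this
    exact h0 this
  have hone : one ∈ ν.support := hν.supp_subset_support _ hy (one_mem_supp_inv_left y)
  refine Set.eq_univ_of_forall fun x => hν.supp_subset_support x hone ?_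
  rw [supp_one_right]
  rfl

/-! ### Closed sets stable under right multiplication -/

theorem isClosed_setOf_exists_mem_supp (x : K) {M : Set K} (hM : IsClosed M) :
    IsClosed {u : K | ∃ m ∈ M, x ∈ supp u m} := by
  have h : IsClosed ({q : K × K | x ∈ supp q.1 q.2} ∩ Prod.snd ⁻¹' M) :=
    (isClosed_setOf_mem_supp.preimage
      (f := fun q : K × K => (q, x)) (by fun_prop)).inter (hM.preimage continuous_snd)
  convert (h.isCompact.image continuous_fst).isClosed using 1
  ext u
  simp only [Set.mem_image, Set.mem_inter_iff, Set.mem_preimage, Set.mem_ofPred_eq]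
  constructor
  · rintro ⟨m, hm, hx⟩
    exact ⟨(u, m), ⟨hx, hm⟩, rfl⟩
  · rintro ⟨⟨u, m⟩, ⟨hx, hm⟩, rfl⟩
    exact ⟨m, hm, hx⟩

theorem mem_interior_setMul_of_mem {U M : Set K} (hU : U ∈ 𝓝 (one : K)) {m : K} (hm : m ∈ M) :
    m ∈ interior (setMul U M) := by
  have hopen : IsOpen {z : K | (supp z (inv m) ∩ interior U).Nonempty} :=
    isOpen_setOf_supp_inter_nonempty continuous_id continuous_const isOpen_interior
  refine interior_maximal ?_ hopen
    ⟨one, one_mem_supp_inv_right m, mem_interior_iff_mem_nhds.2 hU⟩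
  rintro z ⟨w, hw, hwU⟩
  refine mem_setMul.2 ⟨w, interior_subset hwU, m, hm, ?_⟩
  simpa only [inv_inv] using mem_supp_inv_of_mem_supp hw

theorem measure_compl_eq_zero_of_support_subset {μ : Measure K} [μ.Regular] {N : Set K}
    (h : μ.support ⊆ N) : μ Nᶜ = 0 :=
  Filter.mem_of_superset Measure.support_mem_ae_of_regular h

/-- A closed set stable under right multiplication by `s` is stable under right multiplication by
the involution of `s`, provided that the hypergroup carries a left Haar measure. -/
theorem IsLeftInvariant.supp_inv_subset {ω : Measure K} [IsFiniteMeasure ω] [ω.Regular]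
    (hω : IsLeftInvariant ω) (h0 : ω ≠ 0) {M : Set K} (hM : IsClosed M) {s : K}
    (hs : ∀ m ∈ M, supp m s ⊆ M) : ∀ m ∈ M, supp m (inv s) ⊆ M := by
  intro m hm x hx
  by_contra hxM
  have hW : {u : K | ∃ m ∈ M, x ∈ supp u m}ᶜ ∈ 𝓝 (one : K) := by
    refine (isClosed_setOf_exists_mem_supp x hM).isOpen_compl.mem_nhds ?_
    rintro ⟨m', hm', hx'⟩
    rw [supp_one_left] at hx'
    exact hxM (hx' ▸ hm')
  -- Thickening M to N = U * M on the left keeps N closed, stable under s and away from x, but puts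
  -- m in its interior.
  obtain ⟨U, hU, hUcl, hUW⟩ := exists_mem_nhds_isClosed_subset hW
  set N := setMul U M with hN
  have hNcl : IsClosed N := isClosed_setMul hUcl hM
  have hxN : x ∉ N := fun h => by
    obtain ⟨u, hu, m', hm', hx'⟩ := mem_setMul.1 h
    exact hUW hu ⟨m', hm', hx'⟩
  have hNs : ∀ y ∈ N, supp y s ⊆ N := by
    intro y hy z hz
    obtain ⟨u, hu, m', hm', hy'⟩ := mem_setMul.1 hy
    obtain ⟨w, hw, hzw⟩ := exists_mem_supp_of_mem_supp hy' hz
    exact mem_setMul.2 ⟨u, hu, w, hs m' hm' hw, hzw⟩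
  have hfam : IsRegularFamily fun t : K => (conv t s : Measure K) :=
    isRegularFamily_conv continuous_id continuous_const
  have hae := hfam.ae_apply_eq_zero_of_absorbing (hω.bind_conv_map_inv s) hNcl.measurableSet
    (Filter.Eventually.of_forall fun y hy => measure_compl_eq_zero_of_support_subset (hNs y hy))
  have hV : IsOpen {y : K | (supp y s ∩ interior N).Nonempty} :=
    isOpen_setOf_supp_inter_nonempty continuous_id continuous_const isOpen_interior
  -- Points y near x lie outside N, while y * s charges the interior of N because m lies in x * s.
  -- This open set must be null, although ω̌ has full support.
  have hnull : (ω.map inv) ({y : K | (supp y s ∩ interior N).Nonempty} ∩ Nᶜ) = 0 := by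
    refine measure_mono_null ?_ hae
    rintro y ⟨⟨w, hw, hwN⟩, hyN⟩ h
    have hpos := (Measure.mem_support_iff_forall w).1 hw _ (isOpen_interior.mem_nhds hwN)
    exact hpos.ne' (measure_mono_null interior_subset (h hyN))
  have hsupp : x ∈ (ω.map inv).support := by
    rw [mem_support_map_inv, hω.support_eq_univ h0]
    trivial
  have hmx : m ∈ supp x s := by
    simpa only [inv_inv] using mem_supp_inv_of_mem_supp hx
  exact ((Measure.mem_support_iff_forall x).1 hsupp _ ((hV.inter hNcl.isOpen_compl).mem_nhds
    ⟨⟨m, hmx, mem_interior_setMul_of_mem hU hm⟩, hxN⟩)).ne' hnull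

theorem eq_univ_of_forall_supp_subset {A M : Set K} (hM : IsClosed M) (hne : M.Nonempty)
    (h : ∀ a ∈ A, ∀ m ∈ M, supp m a ⊆ M)
    (hA : closure (⋃ n : ℕ, ⋃ _ : 1 ≤ n, setPow A n) = Set.univ) : M = Set.univ := by
  have hpow : ∀ n, ∀ a ∈ setPow A n, ∀ m ∈ M, supp m a ⊆ M := by
    intro n
    induction n with
    | zero =>
      rintro a rfl m hm
      rw [supp_one_right]
      simpa using hm
    | succ n ih =>
      intro b hb m hm
      obtain ⟨c, hc, a, ha, hb'⟩ := mem_setMul.1 hb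
      exact supp_assoc_right hM (fun t ht => h a ha t (ih c hc m hm ht)) b hb'
  have hall : ∀ y, ∀ m ∈ M, supp m y ⊆ M := by
    intro y m hm
    have hcl : IsClosed {y : K | supp m y ⊆ M} :=
      isClosed_setOf_supp_subset continuous_const continuous_id hM
    refine closure_minimal ?_ hcl (hA ▸ Set.mem_univ y)
    exact Set.iUnion_subset fun n => Set.iUnion_subset fun _ a ha => hpow n a ha m hm
  obtain ⟨m, hm⟩ := hne
  have hone : one ∈ M := hall _ m hm (one_mem_supp_inv_right m)
  refine Set.eq_univ_of_forall fun z => hall z one hone ?_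
  rw [supp_one_left]
  rfl

/-! ### The random walk and its stationary measures -/

/-- The transition probabilities `σˇ * δ_x` of the random walk with law `σ`. -/
noncomputable def walk (σ : Measure K) (x : K) : Measure K :=
  σ.bind fun y => (conv (inv y) x : Measure K)

theorem isRegularFamily_conv_inv (x : K) :
    IsRegularFamily fun y : K => (conv (inv y) x : Measure K) :=
  isRegularFamily_conv continuous_inv continuous_const

theorem integral_walk (σ : Measure K) [IsProbabilityMeasure σ] {E : Type*}
    [NormedAddCommGroup E] [NormedSpace ℝ E] {x : K} {f : K → E} (hf : Integrable f (walk σ x)) :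
    ∫ t, f t ∂(walk σ x) = ∫ y, ∫ t, f t ∂(conv (inv y) x : Measure K) ∂σ :=
  (isRegularFamily_conv_inv x).integral_bind hf

theorem isRegularFamily_walk (σ : Measure K) [IsProbabilityMeasure σ] [σ.Regular] :
    IsRegularFamily (walk σ) where
  isProbabilityMeasure x := (isRegularFamily_conv_inv x).isProbabilityMeasure_bind σ
  regular x := (isRegularFamily_conv_inv x).regular_bind σ
  continuous_integral g hg := by
    have hprob : ∀ x, IsProbabilityMeasure (walk σ x) := fun x =>
      (isRegularFamily_conv_inv x).isProbabilityMeasure_bind σ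
    simp only [integral_walk σ (integrable_of_continuous hg)]
    exact continuous_integral_of_continuous_uncurry σ (continuous_integral_conv_comp hg
      (continuous_inv.comp continuous_snd) continuous_fst)

theorem IsLeftInvariant.bind_walk {ω : Measure K} [IsFiniteMeasure ω] [ω.Regular]
    (hω : IsLeftInvariant ω) (σ : Measure K) [IsProbabilityMeasure σ] [σ.Regular] :
    ω.bind (walk σ) = ω := by
  have hm := isRegularFamily_walk σ
  have hprob := hm.isProbabilityMeasure
  have := hm.regular_bind ω
  have := hm.isFiniteMeasure_bind ω
  refine ext_of_integral_continuous fun g hg => ?_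
  rw [hm.integral_bind (integrable_of_continuous hg)]
  simp only [integral_walk σ (integrable_of_continuous hg)]
  rw [integral_integral_swap_of_continuous ω σ
    (f := fun x y => ∫ t, g t ∂(conv (inv y) x : Measure K)) (continuous_integral_conv_comp hg
      (continuous_inv.comp continuous_snd) continuous_fst)]
  simp [hω _ g hg]

/-- With G(z) = ∫ g(z * t) dν(t), this is the mean value property of G under z ↦ δ_z * σ̌.
Associativity moves the step from z onto t, where stationarity absorbs it. -/
theorem integral_stationary {σ ν : Measure K} [IsProbabilityMeasure σ] [σ.Regular]
    [IsFiniteMeasure ν] (hν : ν.bind (walk σ) = ν) {g : K → ℝ} (hg : Continuous g) (z : K) :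
    ∫ y, ∫ s, ∫ t, ∫ u, g u ∂(conv s t : Measure K) ∂ν ∂(conv z (inv y) : Measure K) ∂σ =
      ∫ t, ∫ u, g u ∂(conv z t : Measure K) ∂ν := by
  have hm := isRegularFamily_walk σ
  have hprob := hm.isProbabilityMeasure
  have hgz : Continuous fun t => ∫ u, g u ∂(conv z t : Measure K) :=
    continuous_integral_conv_comp hg continuous_const continuous_id
  have h1 : ∀ y, ∫ s, ∫ t, ∫ u, g u ∂(conv s t : Measure K) ∂ν ∂(conv z (inv y) : Measure K) =
      ∫ t, ∫ s, ∫ u, g u ∂(conv z s : Measure K) ∂(conv (inv y) t : Measure K) ∂ν := by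
    intro y
    rw [integral_integral_swap_of_continuous _ ν (continuous_integral_conv hg)]
    simp only [integral_conv_assoc hg]
  simp only [h1]
  rw [integral_integral_swap_of_continuous σ ν
    (f := fun y t => ∫ s, ∫ u, g u ∂(conv z s : Measure K) ∂(conv (inv y) t : Measure K))
    (continuous_integral_conv_comp hgz (continuous_inv.comp continuous_fst) continuous_snd)]
  have hint : Integrable (fun t => ∫ u, g u ∂(conv z t : Measure K)) (ν.bind (walk σ)) := by
    rw [hν]
    exact integrable_of_continuous hgz
  have h2 := hm.integral_bind hint
  rw [hν] at h2
  rw [h2]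
  simp only [integral_walk σ (integrable_of_continuous hgz)]

theorem IsLeftInvariant.of_stationary {ω : Measure K} [IsFiniteMeasure ω] [ω.Regular]
    (hω : IsLeftInvariant ω) (h0 : ω ≠ 0) {σ : Measure K} [IsProbabilityMeasure σ] [σ.Regular]
    (hσ : IsAdapted σ) {ν : Measure K} [IsFiniteMeasure ν] (hν : ν.bind (walk σ) = ν) :
    IsLeftInvariant ν := by
  intro z g hg
  set G : K → ℝ := fun z => ∫ t, ∫ u, g u ∂(conv z t : Measure K) ∂ν with hG
  have hGc : Continuous G :=
    continuous_integral_of_continuous_uncurry ν (continuous_integral_conv hg)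
  obtain ⟨z₀, -, hz₀⟩ := isCompact_univ.exists_isMaxOn ⟨(one : K), trivial⟩ hGc.continuousOn
  have hmax : ∀ z, G z ≤ G z₀ := fun z => hz₀ (Set.mem_univ z)
  set M : Set K := {z | G z = G z₀} with hM
  have hMcl : IsClosed M := isClosed_eq hGc continuous_const
  have hstep : ∀ a ∈ σ.support, ∀ m ∈ M, supp m (inv a) ⊆ M := by
    intro a ha m hm w hw
    have hd : Continuous fun s => G z₀ - G s := continuous_const.sub hGc
    have hd0 : ∀ s, 0 ≤ G z₀ - G s := fun s => sub_nonneg.2 (hmax s)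
    have hdy : Continuous fun y => ∫ s, (G z₀ - G s) ∂(conv m (inv y) : Measure K) :=
      continuous_integral_conv_comp hd continuous_const continuous_inv
    -- At a maximum point the mean value property averages a nonnegative defect to zero, so the
    -- defect vanishes on each m * ǎ.
    have hzero : ∫ y, ∫ s, (G z₀ - G s) ∂(conv m (inv y) : Measure K) ∂σ = 0 := by
      have h1 : ∀ y, ∫ s, (G z₀ - G s) ∂(conv m (inv y) : Measure K) =
          G z₀ - ∫ s, G s ∂(conv m (inv y) : Measure K) := by
        intro y
        rw [integral_sub (integrable_const _) (integrable_of_continuous hGc)]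
        simp
      simp only [h1]
      rw [integral_sub (integrable_const _) (integrable_of_continuous
        (continuous_integral_conv_comp hGc continuous_const continuous_inv)),
        integral_stationary hν hg m]
      simpa [sub_eq_zero] using hm.symm
    have h2 := Measure.eqOn_zero_support_of_integral_eq_zero hd hd0
      (Measure.eqOn_zero_support_of_integral_eq_zero hdy (fun _ => integral_nonneg hd0) hzero ha) hw
    exact (sub_eq_zero.1 h2).symm
  have huniv : M = Set.univ := by
    refine eq_univ_of_forall_supp_subset hMcl ⟨z₀, rfl⟩ ?_ hσ
    rintro a (ha | ⟨b, hb, rfl⟩)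
    · simpa only [inv_inv] using hω.supp_inv_subset h0 hMcl (hstep a ha)
    · exact hstep b hb
  have hconst : ∀ z, G z = G z₀ := fun z => show z ∈ M from huniv ▸ Set.mem_univ z
  have hone : G one = ∫ t, g t ∂ν := by
    simp only [hG, one_conv]
    simp only [integral_dirac]
  rw [← hone, hconst one, ← hconst z]

/-! ### Uniqueness of Haar measure and ergodicity -/

theorem IsLeftInvariant.smul_eq_smul {ω ν : Measure K} [IsFiniteMeasure ω] [ω.Regular]
    [IsFiniteMeasure ν] [ν.Regular] (hω : IsLeftInvariant ω) (h0 : ω ≠ 0)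
    (hν : IsLeftInvariant ν) : ω Set.univ • ν = ν Set.univ • ω := by
  -- Integrate g(z * t) over ω̌ in z and μ in t, in both orders: μ is left invariant and ω̌ right
  -- invariant.
  have key : ∀ {μ : Measure K} [IsFiniteMeasure μ], IsLeftInvariant μ → ∀ g : K → ℝ,
      Continuous g → ω.real Set.univ * ∫ t, g t ∂μ = μ.real Set.univ * ∫ t, g (inv t) ∂ω := by
    intro μ _ hμ g hg
    have h := integral_integral_swap_of_continuous (ω.map inv) μ
      (f := fun z t => ∫ u, g u ∂(conv z t : Measure K)) (continuous_integral_conv hg)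
    simp only [hμ _ g hg, hω.integral_conv_right_map_inv _ hg, integral_const, smul_eq_mul] at h
    rw [integral_map_inv] at h
    rwa [map_measureReal_apply continuous_inv.measurable MeasurableSet.univ,
      Set.preimage_univ] at h
  have := Measure.Regular.smul (μ := ν) (measure_ne_top ω Set.univ)
  have := Measure.Regular.smul (μ := ω) (measure_ne_top ν Set.univ)
  refine ext_of_integral_continuous fun g hg => ?_
  rw [integral_smul_measure, integral_smul_measure]
  have hpos : ω.real Set.univ ≠ 0 := by
    simpa [Measure.real, ENNReal.toReal_eq_zero_iff] using h0
  have h1 := key hν g hg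
  -- The case μ = ω shows that ω is invariant under the involution.
  have h2 := mul_left_cancel₀ hpos (key hω g hg)
  rw [← h2] at h1
  exact h1

theorem measure_mul_measure_compl_eq_zero {ω : Measure K} [IsFiniteMeasure ω] [ω.Regular]
    (hω : IsLeftInvariant ω) (h0 : ω ≠ 0) {σ : Measure K} [IsProbabilityMeasure σ] [σ.Regular]
    (hσ : IsAdapted σ) {A : Set K} (hA : MeasurableSet A)
    (h : ∀ᵐ x ∂ω, x ∉ A → walk σ x A = 0) : ω A = 0 ∨ ω Aᶜ = 0 := by
  have hm := isRegularFamily_walk σ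
  have hprob := hm.isProbabilityMeasure
  have hstat := hω.bind_walk σ
  have h' : ∀ᵐ x ∂ω, x ∈ A → walk σ x Aᶜ = 0 := by
    simpa using hm.ae_apply_eq_zero_of_absorbing hstat hA.compl (by simpa using h)
  have hres : (ω.restrict A).bind (walk σ) = ω.restrict A := by
    ext B hB
    rw [Measure.bind_apply hB hm.measurable.aemeasurable, Measure.restrict_apply hB,
      ← lintegral_indicator hA]
    conv_rhs => rw [← hstat, Measure.bind_apply (hB.inter hA) hm.measurable.aemeasurable]
    refine lintegral_congr_ae ?_
    filter_upwards [h, h'] with x hx hx'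
    by_cases hxA : x ∈ A
    · rw [Set.indicator_of_mem hxA, measure_inter_conull (hx' hxA)]
    · rw [Set.indicator_of_notMem hxA, measure_mono_null Set.inter_subset_right (hx hxA)]
  have := Measure.Regular.restrict_of_measure_ne_top (measure_ne_top ω A)
  -- Evaluating the proportionality on the complement of A gives 0 = ω(A) · ω(Aᶜ).
  have heq := congrArg (fun μ : Measure K => μ Aᶜ)
    (hω.smul_eq_smul h0 (hω.of_stationary h0 hσ hres))
  simpa [Measure.restrict_apply hA.compl, eq_comm] using heq

/-! ### Harmonic functions are constant -/

theorem ae_walk_apply_pos_eq_zero {ω : Measure K} [IsFiniteMeasure ω] [ω.Regular]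
    (hω : IsLeftInvariant ω) {σ : Measure K} [IsProbabilityMeasure σ] [σ.Regular]
    {u : K → ℝ} (hu : Integrable u ω) (h : ∀ᵐ x ∂ω, ∫ t, u t ∂(walk σ x) = u x) :
    ∀ᵐ x ∂ω, x ∉ {x | 0 < u x} → walk σ x {x | 0 < u x} = 0 := by
  have hm := isRegularFamily_walk σ
  have hprob := hm.isProbabilityMeasure
  have hstat := hω.bind_walk σ
  have hu' : Integrable (fun x => max (u x) 0) (ω.bind (walk σ)) := by
    rw [hstat]
    exact hu.pos_part
  have hP : Integrable (fun x => ∫ t, max (u t) 0 ∂(walk σ x)) ω := by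
    simpa [abs_of_nonneg] using hm.integrable_integral_norm hu'
  have hle : (fun x => max (u x) 0) ≤ᵐ[ω] fun x => ∫ t, max (u t) 0 ∂(walk σ x) := by
    filter_upwards [h, hm.ae_integrable (hstat.symm ▸ hu : Integrable u (ω.bind (walk σ))),
      hm.ae_integrable hu'] with x hx hxu hxP
    refine max_le ?_ (integral_nonneg fun t => le_max_right _ _)
    rw [← hx]
    exact integral_mono hxu hxP fun t => le_max_left _ _
  have hint : ∫ x, max (u x) 0 ∂ω = ∫ x, ∫ t, max (u t) 0 ∂(walk σ x) ∂ω := by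
    rw [← hm.integral_bind hu', hstat]
  have heq := (integral_eq_iff_of_ae_le hu.pos_part hP hle).1 hint
  filter_upwards [heq, hm.ae_integrable hu'] with x hx hxP hxA
  -- Where u ≤ 0, equality says that the positive part of u has zero integral against the transition
  -- measure.
  rw [max_eq_right (not_lt.1 hxA), eq_comm] at hx
  refine measure_mono_null ?_
    ((integral_eq_zero_iff_of_nonneg (fun t => le_max_right (u t) 0) hxP).1 hx)
  intro t ht
  simpa using ht

theorem ae_eq_average_of_harmonic {ω : Measure K} [IsFiniteMeasure ω] [ω.Regular]
    (hω : IsLeftInvariant ω) (h0 : ω ≠ 0) {σ : Measure K} [IsProbabilityMeasure σ] [σ.Regular]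
    (hσ : IsAdapted σ) {u : K → ℝ} (hmeas : Measurable u) (hu : Integrable u ω)
    (h : ∀ᵐ x ∂ω, ∫ t, u t ∂(walk σ x) = u x) : ∀ᵐ x ∂ω, u x = ⨍ t, u t ∂ω := by
  have : NeZero ω := ⟨h0⟩
  have hm := isRegularFamily_walk σ
  have hprob := hm.isProbabilityMeasure
  set c := ⨍ t, u t ∂ω with hc
  have hv : Integrable (fun x => u x - c) ω := hu.sub (integrable_const c)
  have hvint : ∫ x, (u x - c) ∂ω = 0 := integral_sub_average ω u
  have hvh : ∀ᵐ x ∂ω, ∫ t, (u t - c) ∂(walk σ x) = u x - c := by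
    filter_upwards [h, hm.ae_integrable
      ((hω.bind_walk σ).symm ▸ hu : Integrable u (ω.bind (walk σ)))] with x hx hxu
    rw [integral_sub hxu (integrable_const c), hx]
    simp
  have hA : MeasurableSet {x | 0 < u x - c} :=
    measurableSet_lt measurable_const (hmeas.sub_const c)
  rcases measure_mul_measure_compl_eq_zero hω h0 hσ hA (ae_walk_apply_pos_eq_zero hω hv hvh)
    with h1 | h1
  · have hle : ∀ᵐ x ∂ω, 0 ≤ -(u x - c) := by
      filter_upwards [measure_eq_zero_iff_ae_notMem.1 h1] with x hx
      simpa using hx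
    have := (integral_eq_zero_iff_of_nonneg_ae hle hv.neg).1 (by rw [integral_neg, hvint, neg_zero])
    filter_upwards [this] with x hx
    simpa [sub_eq_zero, eq_comm] using hx
  · have hle : ∀ᵐ x ∂ω, 0 ≤ u x - c := by
      filter_upwards [measure_eq_zero_iff_ae_notMem.1 h1] with x hx
      simp only [Set.mem_compl_iff, not_not] at hx
      exact le_of_lt hx
    filter_upwards [(integral_eq_zero_iff_of_nonneg_ae hle hv).1 hvint] with x hx
    exact sub_eq_zero.1 hx

/-- Stationarity makes f integrable for almost every transition measure, so the iterated integral is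
genuine there and not a default value. -/
theorem ae_measureConv_eq_integral_walk {ω : Measure K} [IsFiniteMeasure ω] [ω.Regular]
    (hω : IsLeftInvariant ω) {σ : Measure K} [IsProbabilityMeasure σ] [σ.Regular]
    {f : K → ℂ} (hf : Integrable f ω) :
    ∀ᵐ x ∂ω, Integrable f (walk σ x) ∧ measureConv σ f x = ∫ t, f t ∂(walk σ x) := by
  have hm := isRegularFamily_walk σ
  filter_upwards [hm.ae_integrable
    ((hω.bind_walk σ).symm ▸ hf : Integrable f (ω.bind (walk σ)))] with x hx
  exact ⟨hx, (integral_walk σ hx).symm⟩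

end Compact

end Hypergroup

open Hypergroup in
theorem mainTheorem5 {K : Type*} [TopologicalSpace K] [T2Space K] [CompactSpace K]
    [MeasurableSpace K] [BorelSpace K] [Hypergroup K]
    (ω : Measure K) [ω.Regular] (hω : Hypergroup.IsLeftHaar ω)
    (σ : Measure K) [IsProbabilityMeasure σ] [σ.Regular] (hσ : Hypergroup.IsAdapted σ)
    (p : ℝ≥0∞) (hp : 1 ≤ p) :
    Hypergroup.harmonicLp σ ω p = Set.range (Lp.const p ω : ℂ → Lp ℂ p ω) := by
  have hinv := hω.isLeftInvariant
  have h0 := hω.ne_zero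
  have hm := isRegularFamily_walk σ
  have hprob := hm.isProbabilityMeasure
  have hstat := hinv.bind_walk σ
  ext f
  have hf : Integrable f ω := (Lp.memLp f).integrable hp
  have hconv := ae_measureConv_eq_integral_walk hinv (σ := σ) hf
  have hmeas : Measurable f := (Lp.stronglyMeasurable f).measurable
  constructor
  · intro hfh
    have hfh' : measureConv σ f =ᵐ[ω] f := hfh
    have hre : ∀ᵐ x ∂ω, ∫ t, (f t).re ∂(walk σ x) = (f x).re := by
      filter_upwards [hconv, hfh'] with x hx hx'
      rw [← hx', hx.2]
      exact Complex.reCLM.integral_comp_comm hx.1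
    have him : ∀ᵐ x ∂ω, ∫ t, (f t).im ∂(walk σ x) = (f x).im := by
      filter_upwards [hconv, hfh'] with x hx hx'
      rw [← hx', hx.2]
      exact Complex.imCLM.integral_comp_comm hx.1
    have h1 := ae_eq_average_of_harmonic hinv h0 hσ (Complex.measurable_re.comp hmeas) hf.re hre
    have h2 := ae_eq_average_of_harmonic hinv h0 hσ (Complex.measurable_im.comp hmeas) hf.im him
    refine ⟨⟨⨍ t, (f t).re ∂ω, ⨍ t, (f t).im ∂ω⟩, Lp.ext ?_⟩
    filter_upwards [h1, h2, Lp.coeFn_const p ω (⟨⨍ t, (f t).re ∂ω, ⨍ t, (f t).im ∂ω⟩ : ℂ)] with x hx1 hx2 hx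
    rw [hx]
    exact (Complex.ext hx1 hx2).symm
  · rintro ⟨c, rfl⟩
    have hc : ∀ᵐ x ∂(ω.bind (walk σ)), Lp.const p ω c x = c := by
      rw [hstat]
      exact Lp.coeFn_const p ω c
    change measureConv σ _ =ᵐ[ω] _
    filter_upwards [hconv, Lp.coeFn_const p ω c,
      Measure.ae_ae_of_ae_bind hm.measurable.aemeasurable hc] with x hx hx1 hx2
    rw [hx.2, hx1, integral_congr_ae hx2]
    simp
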